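/- A Bratteli diagram $(V,E)$ consists of a vertex set $V=\bigsqcup_{n\ge 0}V_n$ with $V_n$ finite and non-empty, $V_0=\{v_0\}$, and an edge set $E=\bigsqcup_{n\ge1}E_n$ with $E_n$ finite and non-empty, the edges in $E_n$ going from $V_{n-1}$ to $V_n$. Its incidence matrix has as $(i,j)$ entry the number of edges from $i$ to $j$. Let $A,B$ be integer matrices over the same index set, $A\ge 0$, and let $\Omega_A=\{(i,j):A_{i,j}\ne0\}$. Let $E_A$ be the graph whose vertices are the indices and whose edges are $e_{i,j,n}$, $0\le n<A_{i,j}$, from $i$ to $j$ (source $i$, range $j$); let $E_A^*$ be its finite paths (including vertices), $E_A^\infty$ its infinite paths, with the topology inherited from the product of discrete spaces, and $Z(\alpha)=\{\alpha y: y\in E_A^\infty,\ s(y)=r(\alpha)\}$. For $m\in\mathbb Z$ write $mB_{i,j}+n=kA_{i,j}+l$ with $0\le l<A_{i,j}$ and put $\kappa_m(e_{i,j,n})=e_{i,j,l}$, $\varphi(m,e_{i,j,n})=k$; extend to infinite paths by $\kappa_m(ey)=\kappa_m(e)\,\kappa_{\varphi(m,e)}(y)$. The groupoid $\mathcal G_{A,B}$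 consists of the classes $[\alpha,m,\beta;x]$ with $\alpha,\beta\in E_A^*$, $r(\alpha)=r(\beta)$, $m\in\mathbb Z$, $x\in Z(\beta)$, for the equivalence relation generated by $(\alpha,m,\beta;x)\sim(\alpha\kappa_m(\gamma),\varphi(m,\gamma),\beta\gamma;x)$ whenever $\gamma$ is an edge with $x\in Z(\beta\gamma)$. Its unit space is $E_A^\infty$, with $s([\alpha,m,\beta;\beta y])=\beta y$, $r([\alpha,m,\beta;\beta y])=\alpha\kappa_m(y)$, product $[\alpha,m',\beta;\beta\kappa_m(y)]\,[\beta,m,\gamma;\gamma y]=[\alpha,m'+m,\gamma;\gamma y]$, inverse $[\alpha,m,\beta;\beta y]^{-1}=[\beta,-m,\alpha;\alpha\kappa_m(y)]$, and the topology generated by the sets $\{[\alpha,m,\beta;x]:x\in U\}$ with $U\subseteq Z(\beta)$ open. For a groupoid $\mathcal G$ of this kind, or a restriction of it, a bisection is an open set of arrows on which $s$ and $r$ are injective, and $M(\mathcal G)$ denotes the set of Borel probability measures $\mu$ on the unit space $\mathcal G^{(0)}$ with $\mu(s(U))=\mu(r(U))$ for every bisection $U$. **Lemma.** Let $A$ and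 $B$ be the incidence matrices, over a common index set enumerating the vertices of each, of two Bratteli diagrams $(V,E)$ and $(W,F)$, with $|B_{i,j}|<A_{i,j}$ for all $(i,j)\in\Omega_A$. Let $v_0$ be the initial vertex of $(V,E)$, and let $\tilde{\mathcal G}_{A,B}=\{g\in\mathcal G_{A,B}: s(g),r(g)\in Z(v_0)\}$ and $\tilde{\mathcal G}_{A,0}=\{g\in\mathcal G_{A,0}: s(g),r(g)\in Z(v_0)\}$ be the restrictions to $Z(v_0)$ (with the subspace topology), both with unit space $Z(v_0)$. Then $$M(\tilde{\mathcal G}_{A,B})=M(\tilde{\mathcal G}_{A,0}).$$ -/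

import Mathlib

universe u v

/-! ## Topological groupoids, restrictions, bisections, invariant measures -/

/-- A topological groupoid with unit space (identified with) `X`: a small groupoid whose
objects are the points of `X` and whose arrows form a topological space, all structure maps being
continuous. The product `g · h` is defined when `src g = rng h`. -/
structure TopGroupoid (X : Type u) [TopologicalSpace X] where
  Arrow : Type v
  [topArrow : TopologicalSpace Arrow]
  src : Arrow → X
  rng : Arrow → X
  unit : X → Arrow
  inv : Arrow → Arrow
  mul : ∀ g h : Arrow, src g = rng h → Arrow
  src_unit : ∀ x, src (unit x) = x
  rng_unit : ∀ x, rng (unit x) = x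
  src_inv : ∀ g, src (inv g) = rng g
  rng_inv : ∀ g, rng (inv g) = src g
  src_mul : ∀ g h (e : src g = rng h), src (mul g h e) = src h
  rng_mul : ∀ g h (e : src g = rng h), rng (mul g h e) = rng g
  mul_assoc : ∀ g h k (e : src g = rng h) (e' : src h = rng k),
    mul (mul g h e) k ((src_mul g h e).trans e') = mul g (mul h k e') (e.trans (rng_mul h k e').symm)
  mul_unit : ∀ g, mul g (unit (src g)) (rng_unit _).symm = g
  unit_mul : ∀ g, mul (unit (rng g)) g (src_unit _) = g
  inv_mul : ∀ g, mul (inv g) g (src_inv g) = unit (src g)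
  mul_inv : ∀ g, mul g (inv g) (rng_inv g).symm = unit (rng g)
  continuous_src : Continuous src
  continuous_rng : Continuous rng
  continuous_unit : Continuous unit
  continuous_inv : Continuous inv
  continuous_mul : Continuous
    (fun p : {p : Arrow × Arrow // src p.1 = rng p.2} => mul p.1.1 p.1.2 p.2)

namespace TopGroupoid

attribute [instance] TopGroupoid.topArrow

/-- The restriction `G_Y = {g | s(g) ∈ Y, r(g) ∈ Y}`, a groupoid with unit space `Y`. -/
def restrict {X : Type u} [TopologicalSpace X] (G : TopGroupoid.{u, v} X) (Y : Set X) :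
    TopGroupoid.{u, v} Y where
  Arrow := {g : G.Arrow // G.src g ∈ Y ∧ G.rng g ∈ Y}
  src g := ⟨G.src g.1, g.2.1⟩
  rng g := ⟨G.rng g.1, g.2.2⟩
  unit x := ⟨G.unit x.1, by rw [G.src_unit]; exact x.2, by rw [G.rng_unit]; exact x.2⟩
  inv g := ⟨G.inv g.1, by rw [G.src_inv]; exact g.2.2, by rw [G.rng_inv]; exact g.2.1⟩
  mul g h e := ⟨G.mul g.1 h.1 (congrArg Subtype.val e), by rw [G.src_mul]; exact h.2.1,
    by rw [G.rng_mul]; exact g.2.2⟩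
  src_unit x := Subtype.ext (G.src_unit _)
  rng_unit x := Subtype.ext (G.rng_unit _)
  src_inv g := Subtype.ext (G.src_inv _)
  rng_inv g := Subtype.ext (G.rng_inv _)
  src_mul g h e := Subtype.ext (G.src_mul _ _ _)
  rng_mul g h e := Subtype.ext (G.rng_mul _ _ _)
  mul_assoc g h k e e' := Subtype.ext (G.mul_assoc _ _ _ _ _)
  mul_unit g := Subtype.ext (G.mul_unit _)
  unit_mul g := Subtype.ext (G.unit_mul _)
  inv_mul g := Subtype.ext (G.inv_mul _)
  mul_inv g := Subtype.ext (G.mul_inv _)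
  continuous_src := (G.continuous_src.comp continuous_subtype_val).subtype_mk _
  continuous_rng := (G.continuous_rng.comp continuous_subtype_val).subtype_mk _
  continuous_unit := (G.continuous_unit.comp continuous_subtype_val).subtype_mk _
  continuous_inv := (G.continuous_inv.comp continuous_subtype_val).subtype_mk _
  continuous_mul := by
    refine Continuous.subtype_mk ?_ _
    exact G.continuous_mul.comp (Continuous.subtype_mk
      ((continuous_subtype_val.comp (continuous_fst.comp continuous_subtype_val)).prodMk
        (continuous_subtype_val.comp (continuous_snd.comp continuous_subtype_val)))
      (fun p => congrArg Subtype.val p.2))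

/-- A bisection: an open set of arrows on which `s` and `r` are injective. -/
def IsBisection {X : Type u} [TopologicalSpace X] (G : TopGroupoid.{u, v} X)
    (U : Set G.Arrow) : Prop :=
  IsOpen U ∧ Set.InjOn G.src U ∧ Set.InjOn G.rng U

/-- `M(G)`: the Borel probability measures `μ` on the unit space with `μ(s(U)) = μ(r(U))` for
every bisection `U`. -/
def invariantProbabilityMeasures {X : Type u} [TopologicalSpace X] [MeasurableSpace X]
    [BorelSpace X] (G : TopGroupoid.{u, v} X) : Set (MeasureTheory.ProbabilityMeasure X) :=
  {μ | ∀ U : Set G.Arrow, G.IsBisection U →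
    (μ : MeasureTheory.Measure X) (G.src '' U) = (μ : MeasureTheory.Measure X) (G.rng '' U)}

end TopGroupoid

/-! ## The Katsura-Exel-Pardo groupoid of a pair of integer matrices -/

namespace KatsuraGroupoid

variable {ι : Type u}

/-- The edges `e_{i,j,n}`, `0 ≤ n < A i j`, of the graph of `A`; `src = i`, `tgt = j`, `idx = n`. -/
@[ext] structure Edge (A : Matrix ι ι ℤ) where
  src : ι
  tgt : ι
  idx : ℤ
  idx_nonneg : 0 ≤ idx
  idx_lt : idx < A src tgt

instance (A : Matrix ι ι ℤ) : TopologicalSpace (Edge A) := ⊥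

instance (A : Matrix ι ι ℤ) : DiscreteTopology (Edge A) := ⟨rfl⟩

variable {A : Matrix ι ι ℤ}

lemma Edge.pos (e : Edge A) : 0 < A e.src e.tgt := e.idx_nonneg.trans_lt e.idx_lt

/-- `κ_m(e_{i,j,n}) = e_{i,j,l}`, where `m B_{ij} + n = k A_{ij} + l` and `0 ≤ l < A_{ij}`. -/
def Edge.act (B : Matrix ι ι ℤ) (m : ℤ) (e : Edge A) : Edge A where
  src := e.src
  tgt := e.tgt
  idx := (m * B e.src e.tgt + e.idx) % A e.src e.tgt
  idx_nonneg := Int.emod_nonneg _ e.pos.ne'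
  idx_lt := Int.emod_lt_of_pos _ e.pos

/-- `φ(m, e_{i,j,n}) = k`, where `m B_{ij} + n = k A_{ij} + l` and `0 ≤ l < A_{ij}`. -/
def Edge.cocycle (B : Matrix ι ι ℤ) (m : ℤ) (e : Edge A) : ℤ :=
  (m * B e.src e.tgt + e.idx) / A e.src e.tgt

lemma Edge.act_zero (B : Matrix ι ι ℤ) (e : Edge A) : e.act B 0 = e := by
  ext <;> simp [Edge.act, Int.emod_eq_of_lt e.idx_nonneg e.idx_lt]

lemma Edge.cocycle_zero (B : Matrix ι ι ℤ) (e : Edge A) : e.cocycle B 0 = 0 := by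
  simp [Edge.cocycle, Int.ediv_eq_zero_of_lt e.idx_nonneg e.idx_lt]

lemma Edge.act_add (B : Matrix ι ι ℤ) (m n : ℤ) (e : Edge A) :
    e.act B (m + n) = (e.act B n).act B m := by
  ext
  · rfl
  · rfl
  · simp only [Edge.act, Int.add_emod_emod]
    ring_nf

lemma Edge.cocycle_add (B : Matrix ι ι ℤ) (m n : ℤ) (e : Edge A) :
    e.cocycle B (m + n) = (e.act B n).cocycle B m + e.cocycle B n := by
  simp only [Edge.cocycle, Edge.act]
  rw [← Int.add_mul_ediv_right _ _ e.pos.ne']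
  congr 1
  have := Int.emod_add_ediv_mul (n * B e.src e.tgt + e.idx) (A e.src e.tgt)
  linarith

/-- `l` is the list of edges of a finite path starting at `v`. -/
def IsPathFrom : ι → List (Edge A) → Prop
  | _, [] => True
  | v, e :: l => e.src = v ∧ IsPathFrom e.tgt l

/-- The end vertex of the finite path starting at `v` with list of edges `l`. -/
def endVertex : ι → List (Edge A) → ι
  | v, [] => v
  | _, e :: l => endVertex e.tgt l

lemma isPathFrom_snoc (v : ι) (l : List (Edge A)) (e : Edge A) (hl : IsPathFrom v l)
    (he : endVertex v l = e.src) : IsPathFrom v (l ++ [e]) := by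
  induction l generalizing v with
  | nil => exact ⟨he.symm, trivial⟩
  | cons a l ih => exact ⟨hl.1, ih _ hl.2 he⟩

lemma endVertex_snoc (v : ι) (l : List (Edge A)) (e : Edge A) :
    endVertex v (l ++ [e]) = e.tgt := by
  induction l generalizing v with
  | nil => rfl
  | cons a l ih => exact ih _

/-- Finite paths, including the paths of length zero (the vertices). -/
@[ext] structure FinPath (A : Matrix ι ι ℤ) where
  source : ι
  edges : List (Edge A)
  isPath : IsPathFrom source edges

namespace FinPath

def range (α : FinPath A) : ι := endVertex α.source α.edges

def length (α : FinPath A) : ℕ := α.edges.length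

/-- The path `α e`. -/
def snoc (α : FinPath A) (e : Edge A) (h : α.range = e.src) : FinPath A :=
  ⟨α.source, α.edges ++ [e], isPathFrom_snoc _ _ _ α.isPath h⟩

/-- The path of length zero at `v`. -/
def vertex (A : Matrix ι ι ℤ) (v : ι) : FinPath A := ⟨v, [], trivial⟩

lemma range_snoc (α : FinPath A) (e : Edge A) (h : α.range = e.src) :
    (α.snoc e h).range = e.tgt := endVertex_snoc _ _ _

lemma length_snoc (α : FinPath A) (e : Edge A) (h : α.range = e.src) :
    (α.snoc e h).length = α.length + 1 := by
  simp [snoc, length]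

end FinPath

/-- The sequence obtained by putting the list `l` in front of the sequence `y`. -/
def seqAppend : List (Edge A) → (ℕ → Edge A) → ℕ → Edge A
  | [], y, n => y n
  | e :: _, _, 0 => e
  | _ :: l, y, n + 1 => seqAppend l y n

lemma seqAppend_snoc (l : List (Edge A)) (e : Edge A) (y : ℕ → Edge A) (z : ℕ → Edge A)
    (h0 : z 0 = e) (h1 : ∀ n, z (n + 1) = y n) :
    seqAppend (l ++ [e]) y = seqAppend l z := by
  induction l with
  | nil =>
    funext n
    cases n with
    | zero => exact h0.symm
    | succ n => exact (h1 n).symm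
  | cons a l ih =>
    funext n
    cases n with
    | zero => rfl
    | succ n => exact congrFun ih n

lemma seqAppend_inj (l l' : List (Edge A)) (y y' : ℕ → Edge A) (h : l.length = l'.length)
    (e : seqAppend l y = seqAppend l' y') : l = l' ∧ y = y' := by
  induction l generalizing l' with
  | nil =>
    cases l' with
    | nil => exact ⟨rfl, e⟩
    | cons a l' => simp at h
  | cons a l ih =>
    cases l' with
    | nil => simp at h
    | cons a' l' =>
      have h0 : a = a' := congrFun e 0
      obtain ⟨h1, h2⟩ := ih l' (by simpa using h) (funext fun n => congrFun e (n + 1))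
      exact ⟨by rw [h0, h1], h2⟩

lemma seqAppend_isPath (v : ι) (l : List (Edge A)) (y : ℕ → Edge A)
    (hl : IsPathFrom v l) (hy : ∀ n, (y n).tgt = (y (n + 1)).src)
    (h : endVertex v l = (y 0).src) :
    (seqAppend l y 0).src = v ∧ ∀ n, (seqAppend l y n).tgt = (seqAppend l y (n + 1)).src := by
  induction l generalizing v with
  | nil => exact ⟨h.symm, hy⟩
  | cons a l ih =>
    obtain ⟨h1, h2⟩ := ih _ hl.2 h
    refine ⟨hl.1, fun n => ?_⟩
    cases n with
    | zero => exact h1.symm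
    | succ n => exact h2 n

/-- Infinite paths. -/
@[ext] structure InfPath (A : Matrix ι ι ℤ) where
  edge : ℕ → Edge A
  isPath : ∀ n, (edge n).tgt = (edge (n + 1)).src

/-- The infinite path space is a subspace of the product of countably many copies of the discrete
set of edges. -/
instance (A : Matrix ι ι ℤ) : TopologicalSpace (InfPath A) :=
  TopologicalSpace.induced InfPath.edge inferInstance

instance (A : Matrix ι ι ℤ) : MeasurableSpace (InfPath A) := borel _

instance (A : Matrix ι ι ℤ) : BorelSpace (InfPath A) := ⟨rfl⟩

namespace InfPath

def source (x : InfPath A) : ι := (x.edge 0).src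

def tail (x : InfPath A) : InfPath A := ⟨fun n => x.edge (n + 1), fun n => x.isPath (n + 1)⟩

/-- `φ(m, y_{|n})`, by the recursion `φ(m, αe) = φ(φ(m, α), e)`. -/
def cocycle (B : Matrix ι ι ℤ) (m : ℤ) (y : InfPath A) : ℕ → ℤ
  | 0 => m
  | n + 1 => (y.edge n).cocycle B (cocycle B m y n)

/-- The action on infinite paths: the `n`-th edge `e` of `κ_m(y)` is `κ_k(y_n)`, where `k` is the
value of the cocycle on `m` and the initial segment of `y` before `y_n`. -/
def act (B : Matrix ι ι ℤ) (m : ℤ) (y : InfPath A) : InfPath A :=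
  ⟨fun n => (y.edge n).act B (cocycle B m y n), fun n => y.isPath n⟩

lemma source_act (B : Matrix ι ι ℤ) (m : ℤ) (y : InfPath A) : (y.act B m).source = y.source := rfl

lemma cocycle_zero (B : Matrix ι ι ℤ) (y : InfPath A) (n : ℕ) : cocycle B 0 y n = 0 := by
  induction n with
  | zero => rfl
  | succ n ih => simp [cocycle, ih, Edge.cocycle_zero]

lemma act_zero (B : Matrix ι ι ℤ) (y : InfPath A) : y.act B 0 = y := by
  apply InfPath.ext
  funext n
  simp [act, cocycle_zero, Edge.act_zero]

lemma cocycle_add (B : Matrix ι ι ℤ) (m k : ℤ) (y : InfPath A) (n : ℕ) :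
    cocycle B (m + k) y n = cocycle B m (y.act B k) n + cocycle B k y n := by
  induction n with
  | zero => rfl
  | succ n ih => simp only [cocycle, ih, Edge.cocycle_add]; rfl

lemma act_add (B : Matrix ι ι ℤ) (m k : ℤ) (y : InfPath A) :
    y.act B (m + k) = (y.act B k).act B m := by
  apply InfPath.ext
  funext n
  simp only [act, cocycle_add, Edge.act_add]

lemma cocycle_succ (B : Matrix ι ι ℤ) (m : ℤ) (y : InfPath A) (n : ℕ) :
    cocycle B m y (n + 1) = cocycle B ((y.edge 0).cocycle B m) y.tail n := by
  induction n with
  | zero => rfl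
  | succ n ih => rw [cocycle, ih]; rfl

lemma tail_act (B : Matrix ι ι ℤ) (m : ℤ) (y : InfPath A) :
    (y.act B m).tail = y.tail.act B ((y.edge 0).cocycle B m) := by
  apply InfPath.ext
  funext n
  simp only [tail, act, cocycle_succ]

end InfPath

namespace FinPath

/-- The infinite path `α y`. -/
def concat (α : FinPath A) (y : InfPath A) (h : α.range = y.source) : InfPath A :=
  ⟨seqAppend α.edges y.edge, (seqAppend_isPath _ _ _ α.isPath y.isPath h).2⟩

/-- `Z(α)`. -/
def cylinder (α : FinPath A) : Set (InfPath A) :=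
  {x | ∃ (y : InfPath A) (h : α.range = y.source), x = α.concat y h}

lemma source_concat (α : FinPath A) (y : InfPath A) (h : α.range = y.source) :
    (α.concat y h).source = α.source := (seqAppend_isPath _ _ _ α.isPath y.isPath h).1

lemma concat_inj (α α' : FinPath A) (y y' : InfPath A) (h : α.range = y.source)
    (h' : α'.range = y'.source) (hl : α.length = α'.length)
    (e : α.concat y h = α'.concat y' h') : α = α' ∧ y = y' := by
  have h1 := seqAppend_inj _ _ _ _ hl (congrArg InfPath.edge e)
  refine ⟨FinPath.ext ?_ h1.1, InfPath.ext h1.2⟩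
  rw [← source_concat α y h, ← source_concat α' y' h', e]

end FinPath

/-- A quadruple `(α, m, β; x)` with `r(α) = r(β)` and `x = β y ∈ Z(β)`; since `x` and `y`
determine each other, it is the tail `y` that is recorded. -/
@[ext] structure Quad (A : Matrix ι ι ℤ) where
  left : FinPath A
  deg : ℤ
  right : FinPath A
  tail : InfPath A
  left_range : left.range = tail.source
  right_range : right.range = tail.source

namespace Quad

/-- `x = β y`. -/
def src (q : Quad A) : InfPath A := q.right.concat q.tail q.right_range

/-- `α κ_m(y)`. -/
def rng (B : Matrix ι ι ℤ) (q : Quad A) : InfPath A :=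
  q.left.concat (q.tail.act B q.deg) q.left_range

/-- For `x = β γ y'` with `γ` an edge, the passage from `(α, m, β; x)` to
`(α κ_m(γ), φ(m, γ), β γ; x)`. -/
def refine (B : Matrix ι ι ℤ) (q : Quad A) : Quad A where
  left := q.left.snoc ((q.tail.edge 0).act B q.deg) q.left_range
  deg := (q.tail.edge 0).cocycle B q.deg
  right := q.right.snoc (q.tail.edge 0) q.right_range
  tail := q.tail.tail
  left_range := (FinPath.range_snoc _ _ _).trans (q.tail.isPath 0)
  right_range := (FinPath.range_snoc _ _ _).trans (q.tail.isPath 0)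

lemma src_refine (B : Matrix ι ι ℤ) (q : Quad A) : (q.refine B).src = q.src := by
  apply InfPath.ext
  exact seqAppend_snoc _ _ _ _ rfl (fun n => rfl)

lemma rng_refine (B : Matrix ι ι ℤ) (q : Quad A) : (q.refine B).rng B = q.rng B := by
  apply InfPath.ext
  refine seqAppend_snoc _ _ _ _ rfl (fun n => ?_)
  exact congrArg (fun z : InfPath A => z.edge n) (InfPath.tail_act B q.deg q.tail)

end Quad

/-- The arrows of `G_{A,B}`: quadruples modulo the equivalence relation generated by
`(α, m, β; x) ∼ (α κ_m(γ), φ(m, γ), β γ; x)`. -/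
def Arrow (A B : Matrix ι ι ℤ) : Type u :=
  Quot (fun q q' : Quad A => q' = q.refine B)

variable {B : Matrix ι ι ℤ}

namespace Arrow

/-- The class `[α, m, β; x]`. -/
def mk (B : Matrix ι ι ℤ) (q : Quad A) : Arrow A B := Quot.mk _ q

def src (g : Arrow A B) : InfPath A :=
  Quot.lift Quad.src (fun q q' h => by rw [h, Quad.src_refine]) g

def rng (g : Arrow A B) : InfPath A :=
  Quot.lift (Quad.rng B) (fun q q' h => by rw [h, Quad.rng_refine]) g

/-- The set `Z(α, m, β; U) = {[α, m, β; x] | x ∈ U}`. -/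
def basicSet (B : Matrix ι ι ℤ) (α : FinPath A) (m : ℤ) (β : FinPath A) (U : Set (InfPath A)) :
    Set (Arrow A B) :=
  {g | ∃ q : Quad A, q.left = α ∧ q.deg = m ∧ q.right = β ∧ q.src ∈ U ∧ g = mk B q}

/-- The topology of `G_{A,B}`, generated by the sets `Z(α, m, β; U)` with `U ⊆ Z(β)` open. (If `A`
is row-finite, each such `U` is a union of compact open sets, so that the compact open `U` give the
same topology.) -/
instance : TopologicalSpace (Arrow A B) :=
  TopologicalSpace.generateFrom
    {S | ∃ (α : FinPath A) (m : ℤ) (β : FinPath A) (U : Set (InfPath A)),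
      α.range = β.range ∧ IsOpen U ∧ U ⊆ β.cylinder ∧ S = basicSet B α m β U}

lemma mk_refine (q : Quad A) : mk B (q.refine B) = mk B q := (Quot.sound (r := fun q q' : Quad A => q' = q.refine B) rfl).symm

lemma mk_iterate (q : Quad A) (n : ℕ) : mk B ((Quad.refine B)^[n] q) = mk B q := by
  induction n with
  | zero => rfl
  | succ n ih => rw [Function.iterate_succ_apply', mk_refine, ih]

lemma mk_eq_iff (q q' : Quad A) :
    mk B q = mk B q' ↔ ∃ n n', (Quad.refine B)^[n] q = (Quad.refine B)^[n'] q' := by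
  constructor
  · intro h
    have h' := Quot.eqvGen_exact h
    clear h
    induction h' with
    | rel x y h => exact ⟨1, 0, h.symm⟩
    | refl x => exact ⟨0, 0, rfl⟩
    | symm x y _ ih =>
      obtain ⟨n, n', e⟩ := ih
      exact ⟨n', n, e.symm⟩
    | trans x y z _ _ ih1 ih2 =>
      obtain ⟨a, b, e1⟩ := ih1
      obtain ⟨c, d, e2⟩ := ih2
      refine ⟨c + a, b + d, ?_⟩
      rw [Function.iterate_add_apply, e1, ← Function.iterate_add_apply, Nat.add_comm c b,
        Function.iterate_add_apply, e2, ← Function.iterate_add_apply]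
  · rintro ⟨n, n', e⟩
    rw [← mk_iterate q n, e, mk_iterate]

end Arrow

namespace Quad

lemma src_iterate (q : Quad A) (n : ℕ) : ((refine B)^[n] q).src = q.src := by
  induction n with
  | zero => rfl
  | succ n ih => rw [Function.iterate_succ_apply', src_refine, ih]

lemma rng_iterate (q : Quad A) (n : ℕ) : ((refine B)^[n] q).rng B = q.rng B := by
  induction n with
  | zero => rfl
  | succ n ih => rw [Function.iterate_succ_apply', rng_refine, ih]

lemma length_left_iterate (q : Quad A) (n : ℕ) :
    ((refine B)^[n] q).left.length = q.left.length + n := by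
  induction n with
  | zero => rfl
  | succ n ih =>
    rw [Function.iterate_succ_apply', ← Nat.add_assoc, ← ih]
    simp [refine, FinPath.snoc, FinPath.length]

lemma length_right_iterate (q : Quad A) (n : ℕ) :
    ((refine B)^[n] q).right.length = q.right.length + n := by
  induction n with
  | zero => rfl
  | succ n ih =>
    rw [Function.iterate_succ_apply', ← Nat.add_assoc, ← ih]
    simp [refine, FinPath.snoc, FinPath.length]

/-- `q = (α, m', β; β κ_m(y))` and `p = (β, m, γ; γ y)`. -/
def Composable (B : Matrix ι ι ℤ) (q p : Quad A) : Prop :=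
  q.right = p.left ∧ q.tail = p.tail.act B p.deg

/-- For composable quadruples `(α, m', β; β κ_m(y))` and `(β, m, γ; γ y)`, the quadruple
`(α, m' + m, γ; γ y)`. -/
def comp (q p : Quad A) (h : Composable B q p) : Quad A where
  left := q.left
  deg := q.deg + p.deg
  right := p.right
  tail := p.tail
  left_range := by rw [q.left_range, h.2]; rfl
  right_range := p.right_range

lemma composable_of (q p : Quad A) (h : q.src = p.rng B)
    (hl : q.right.length = p.left.length) : Composable B q p :=
  FinPath.concat_inj _ _ _ _ _ _ hl h

lemma Composable.src_eq {q p : Quad A} (h : Composable B q p) : q.src = p.rng B := by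
  apply InfPath.ext
  simp only [src, rng, FinPath.concat, h.1, h.2]

lemma Composable.refine {q p : Quad A} (h : Composable B q p) :
    Composable B (q.refine B) (p.refine B) := by
  apply composable_of
  · rw [src_refine, rng_refine, h.src_eq]
  · simp [Quad.refine, FinPath.snoc, FinPath.length, h.1]

lemma comp_refine {q p : Quad A} (h : Composable B q p) :
    comp (q.refine B) (p.refine B) h.refine = (comp q p h).refine B := by
  have e0 : q.tail.edge 0 = (p.tail.edge 0).act B p.deg := by rw [h.2]; rfl
  apply Quad.ext
  · apply FinPath.ext
    · rfl
    · simp only [comp, Quad.refine, FinPath.snoc, e0, Edge.act_add]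
  · simp only [comp, Quad.refine, e0, Edge.cocycle_add]
  · rfl
  · rfl

lemma comp_iterate {q p : Quad A} (h : Composable B q p) (n : ℕ) :
    ∃ h' : Composable B ((Quad.refine B)^[n] q) ((Quad.refine B)^[n] p),
      comp _ _ h' = (Quad.refine B)^[n] (comp q p h) := by
  induction n with
  | zero => exact ⟨h, rfl⟩
  | succ n ih =>
    obtain ⟨h', e⟩ := ih
    simp only [Function.iterate_succ_apply']
    exact ⟨h'.refine, (comp_refine h').trans (congrArg _ e)⟩

lemma src_comp {q p : Quad A} (h : Composable B q p) : (comp q p h).src = p.src := rfl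

lemma rng_comp {q p : Quad A} (h : Composable B q p) : (comp q p h).rng B = q.rng B := by
  apply InfPath.ext
  simp only [rng, FinPath.concat, comp, h.2, InfPath.act_add]

/-- For `x = β y`, the passage from `(α, m, β; x)` to `(β, -m, α; α κ_m(y))`. -/
def inv (B : Matrix ι ι ℤ) (q : Quad A) : Quad A where
  left := q.right
  deg := -q.deg
  right := q.left
  tail := q.tail.act B q.deg
  left_range := q.right_range
  right_range := q.left_range

lemma src_inv (q : Quad A) : (q.inv B).src = q.rng B := rfl

lemma rng_inv (q : Quad A) : (q.inv B).rng B = q.src := by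
  apply InfPath.ext
  simp only [rng, src, FinPath.concat, inv, ← InfPath.act_add, neg_add_cancel, InfPath.act_zero]

lemma inv_refine (q : Quad A) : (q.refine B).inv B = (q.inv B).refine B := by
  have h1 := Edge.act_add B (-q.deg) q.deg (q.tail.edge 0)
  have h2 := Edge.cocycle_add B (-q.deg) q.deg (q.tail.edge 0)
  rw [neg_add_cancel, Edge.act_zero] at h1
  rw [neg_add_cancel, Edge.cocycle_zero] at h2
  apply Quad.ext
  · apply FinPath.ext
    · rfl
    · exact congrArg (fun e => q.right.edges ++ [e]) h1
  · change -((q.tail.edge 0).cocycle B q.deg) =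
      ((q.tail.edge 0).act B q.deg).cocycle B (-q.deg)
    linarith
  · rfl
  · exact (InfPath.tail_act B q.deg q.tail).symm

lemma inv_iterate (q : Quad A) (n : ℕ) :
    ((refine B)^[n] q).inv B = (refine B)^[n] (q.inv B) := by
  induction n with
  | zero => rfl
  | succ n ih => rw [Function.iterate_succ_apply', inv_refine, ih, Function.iterate_succ_apply']

/-- The quadruple `(β, 0, β; β y)`. -/
def idem (β : FinPath A) (y : InfPath A) (h : β.range = y.source) : Quad A := ⟨β, 0, β, y, h, h⟩

lemma rng_idem (β : FinPath A) (y : InfPath A) (h : β.range = y.source) :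
    (idem β y h).rng B = (idem β y h).src := by
  apply InfPath.ext
  simp only [rng, src, FinPath.concat, idem, InfPath.act_zero]

lemma refine_idem (β : FinPath A) (y : InfPath A) (h : β.range = y.source) :
    ∃ h', (idem β y h).refine B = idem (β.snoc (y.edge 0) h) y.tail h' := by
  refine ⟨(FinPath.range_snoc _ _ _).trans (y.isPath 0), ?_⟩
  apply Quad.ext
  · apply FinPath.ext
    · rfl
    · simp only [idem, Quad.refine, FinPath.snoc, Edge.act_zero]
  · simp only [idem, Quad.refine, Edge.cocycle_zero]
  · rfl
  · rfl

lemma iterate_idem (β : FinPath A) (y : InfPath A) (h : β.range = y.source) (n : ℕ) :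
    ∃ β' y' h', (Quad.refine B)^[n] (idem β y h) = idem β' y' h' := by
  induction n with
  | zero => exact ⟨β, y, h, rfl⟩
  | succ n ih =>
    obtain ⟨β', y', h', e⟩ := ih
    obtain ⟨h'', e'⟩ := refine_idem (B := B) β' y' h'
    exact ⟨_, _, h'', by rw [Function.iterate_succ_apply', e, e']⟩

end Quad

namespace Arrow

/-- The unit `[v, 0, v; x]` at `x`, where `v` is the source of `x`. -/
def unit (B : Matrix ι ι ℤ) (x : InfPath A) : Arrow A B :=
  mk B (Quad.idem (FinPath.vertex A x.source) x rfl)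

/-- `[α, m, β; β y]⁻¹ = [β, -m, α; α κ_m(y)]`. -/
def inv (g : Arrow A B) : Arrow A B :=
  Quot.lift (fun q => mk B (q.inv B))
    (fun q q' h => by rw [h, Quad.inv_refine, mk_refine]) g

/-- `k = g · h`, that is, `g = [α, m', β; β κ_m(y)]`, `h = [β, m, γ; γ y]` and
`k = [α, m' + m, γ; γ y]` for some representatives. -/
def IsProduct (g h k : Arrow A B) : Prop :=
  ∃ (q p : Quad A) (c : Quad.Composable B q p), g = mk B q ∧ h = mk B p ∧ k = mk B (q.comp p c)

lemma IsProduct.unique {g h k k' : Arrow A B} (H : IsProduct g h k) (H' : IsProduct g h k') :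
    k = k' := by
  obtain ⟨q, p, c, hg, hh, rfl⟩ := H
  obtain ⟨q', p', c', hg', hh', rfl⟩ := H'
  obtain ⟨a, b, e1⟩ := (mk_eq_iff q q').1 (hg.symm.trans hg')
  obtain ⟨s, t, e2⟩ := (mk_eq_iff p p').1 (hh.symm.trans hh')
  have f1 : (Quad.refine B)^[a + s] q = (Quad.refine B)^[b + s] q' := by
    rw [Nat.add_comm a, Nat.add_comm b, Function.iterate_add_apply, e1,
      ← Function.iterate_add_apply]
  have f2 : (Quad.refine B)^[a + s] p = (Quad.refine B)^[a + t] p' := by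
    rw [Function.iterate_add_apply, e2, ← Function.iterate_add_apply]
  have l1 := congrArg (fun z : Quad A => z.right.length) f1
  have l2 := congrArg (fun z : Quad A => z.left.length) f2
  simp only [Quad.length_right_iterate, Quad.length_left_iterate] at l1 l2
  rw [c.1] at l1
  rw [c'.1] at l1
  have e3 : a + t = b + s := by omega
  rw [e3] at f2
  obtain ⟨d, ed⟩ := Quad.comp_iterate c (a + s)
  obtain ⟨d', ed'⟩ := Quad.comp_iterate c' (b + s)
  have : Quad.comp _ _ d = Quad.comp _ _ d' := by congr 1
  rw [ed, ed'] at this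
  exact (mk_eq_iff _ _).2 ⟨_, _, this⟩

lemma exists_mk (g : Arrow A B) : ∃ q, g = mk B q := by
  obtain ⟨q, rfl⟩ := Quot.exists_rep g
  exact ⟨q, rfl⟩

lemma IsProduct.exists {g h : Arrow A B} (e : src g = rng h) : ∃ k, IsProduct g h k := by
  obtain ⟨q, rfl⟩ := exists_mk g
  obtain ⟨p, rfl⟩ := exists_mk h
  have c : Quad.Composable B ((Quad.refine B)^[p.left.length] q)
      ((Quad.refine B)^[q.right.length] p) := by
    apply Quad.composable_of
    · rw [Quad.src_iterate, Quad.rng_iterate]; exact e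
    · rw [Quad.length_right_iterate, Quad.length_left_iterate, Nat.add_comm]
  exact ⟨_, _, _, c, (mk_iterate _ _).symm, (mk_iterate _ _).symm, rfl⟩

/-- The product `g · h`. -/
noncomputable def mul (g h : Arrow A B) (e : src g = rng h) : Arrow A B :=
  Classical.choose (IsProduct.exists e)

lemma mul_spec (g h : Arrow A B) (e : src g = rng h) : IsProduct g h (mul g h e) :=
  Classical.choose_spec (IsProduct.exists e)

lemma mul_mk {q p : Quad A} (c : Quad.Composable B q p) (e : src (mk B q) = rng (mk B p)) :
    mul (mk B q) (mk B p) e = mk B (q.comp p c) :=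
  (mul_spec _ _ e).unique ⟨q, p, c, rfl, rfl, rfl⟩

lemma mul_eq {g h k : Arrow A B} (H : IsProduct g h k) (e : src g = rng h) : mul g h e = k :=
  (mul_spec _ _ e).unique H

lemma src_mul (g h : Arrow A B) (e : src g = rng h) : src (mul g h e) = src h := by
  obtain ⟨q, p, c, -, rfl, hk⟩ := mul_spec g h e
  rw [hk]; rfl

lemma rng_mul (g h : Arrow A B) (e : src g = rng h) : rng (mul g h e) = rng g := by
  obtain ⟨q, p, c, rfl, -, hk⟩ := mul_spec g h e
  rw [hk]; exact Quad.rng_comp c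

lemma mul_assoc (g h k : Arrow A B) (e : src g = rng h) (e' : src h = rng k) :
    mul (mul g h e) k ((src_mul g h e).trans e') =
      mul g (mul h k e') (e.trans (rng_mul h k e').symm) := by
  obtain ⟨q, rfl⟩ := exists_mk g
  obtain ⟨p, rfl⟩ := exists_mk h
  obtain ⟨r, rfl⟩ := exists_mk k
  have key : ∃ q' p' r', ∃ (c : Quad.Composable B q' p') (d : Quad.Composable B p' r'),
      mk B q = mk B q' ∧ mk B p = mk B p' ∧ mk B r = mk B r' := by
    refine ⟨(Quad.refine B)^[p.left.length + r.left.length] q,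
      (Quad.refine B)^[q.right.length + r.left.length] p,
      (Quad.refine B)^[p.right.length + q.right.length] r, ?_, ?_,
      (mk_iterate _ _).symm, (mk_iterate _ _).symm, (mk_iterate _ _).symm⟩
    · apply Quad.composable_of
      · rw [Quad.src_iterate, Quad.rng_iterate]; exact e
      · rw [Quad.length_right_iterate, Quad.length_left_iterate]; omega
    · apply Quad.composable_of
      · rw [Quad.src_iterate, Quad.rng_iterate]; exact e'
      · rw [Quad.length_right_iterate, Quad.length_left_iterate]; omega
  obtain ⟨q', p', r', c, d, h1, h2, h3⟩ := key
  have c' : Quad.Composable B (q'.comp p' c) r' := d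
  have d' : Quad.Composable B q' (p'.comp r' d) := by
    refine ⟨c.1, ?_⟩
    rw [c.2, d.2, ← InfPath.act_add]; rfl
  have a1 : mul (mk B q) (mk B p) e = mk B (q'.comp p' c) := mul_eq ⟨q', p', c, h1, h2, rfl⟩ e
  have a2 : mul (mk B p) (mk B r) e' = mk B (p'.comp r' d) := mul_eq ⟨p', r', d, h2, h3, rfl⟩ e'
  rw [mul_eq ⟨_, _, c', a1, h3, rfl⟩, mul_eq ⟨_, _, d', h1, a2, rfl⟩]
  congr 1
  apply Quad.ext
  · rfl
  · exact add_assoc _ _ _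
  · rfl
  · rfl

lemma unit_src (q : Quad A) : unit B q.src = mk B (Quad.idem q.right q.tail q.right_range) := by
  rw [unit, mk_eq_iff]
  refine ⟨q.right.length, 0, ?_⟩
  obtain ⟨β', y', h', e⟩ := Quad.iterate_idem (B := B) (FinPath.vertex A q.src.source) q.src rfl
    q.right.length
  have hl : β'.length = q.right.length := by
    have := congrArg (fun z : Quad A => z.right.length) e
    simp only [Quad.length_right_iterate] at this
    rw [← show _ = β'.length from this]
    exact Nat.zero_add _
  have hs : β'.concat y' h' = q.right.concat q.tail q.right_range := by
    have := congrArg Quad.src e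
    rw [Quad.src_iterate] at this
    exact this.symm
  obtain ⟨rfl, rfl⟩ := FinPath.concat_inj _ _ _ _ _ _ hl hs
  exact e

lemma src_inv (g : Arrow A B) : src (inv g) = rng g := by
  obtain ⟨q, rfl⟩ := exists_mk g
  rfl

lemma rng_inv (g : Arrow A B) : rng (inv g) = src g := by
  obtain ⟨q, rfl⟩ := exists_mk g
  exact Quad.rng_inv q

lemma src_unit (x : InfPath A) : src (unit B x) = x := rfl

lemma rng_unit (x : InfPath A) : rng (unit B x) = x := Quad.rng_idem _ _ _

lemma mul_unit (g : Arrow A B) : mul g (unit B (src g)) (rng_unit _).symm = g := by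
  obtain ⟨q, rfl⟩ := exists_mk g
  refine mul_eq ⟨q, Quad.idem q.right q.tail q.right_range,
    ⟨rfl, (InfPath.act_zero _ _).symm⟩, rfl, unit_src q, ?_⟩ _
  congr 1
  apply Quad.ext
  · rfl
  · exact (add_zero _).symm
  · rfl
  · rfl

lemma unit_rng (q : Quad A) : unit B (q.rng B) =
    mk B (Quad.idem q.left (q.tail.act B q.deg) q.left_range) :=
  unit_src (q.inv B)

lemma unit_mul (g : Arrow A B) : mul (unit B (rng g)) g (src_unit _) = g := by
  obtain ⟨q, rfl⟩ := exists_mk g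
  refine mul_eq ⟨Quad.idem q.left (q.tail.act B q.deg) q.left_range, q,
    ⟨rfl, rfl⟩, unit_rng q, rfl, ?_⟩ _
  congr 1
  apply Quad.ext
  · rfl
  · exact (zero_add _).symm
  · rfl
  · rfl

lemma inv_mul (g : Arrow A B) : mul (inv g) g (src_inv g) = unit B (src g) := by
  obtain ⟨q, rfl⟩ := exists_mk g
  refine mul_eq ⟨q.inv B, q, ⟨rfl, rfl⟩, rfl, rfl, ?_⟩ _
  refine (unit_src q).trans ?_
  congr 1
  apply Quad.ext
  · rfl
  · exact (neg_add_cancel _).symm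
  · rfl
  · rfl

lemma mul_inv (g : Arrow A B) : mul g (inv g) (rng_inv g).symm = unit B (rng g) := by
  obtain ⟨q, rfl⟩ := exists_mk g
  have c : Quad.Composable B q (q.inv B) :=
    ⟨rfl, by simp only [Quad.inv, ← InfPath.act_add, neg_add_cancel, InfPath.act_zero]⟩
  refine mul_eq ⟨q, q.inv B, c, rfl, rfl, ?_⟩ _
  refine (unit_rng q).trans ?_
  congr 1
  apply Quad.ext
  · rfl
  · exact (add_neg_cancel _).symm
  · rfl
  · rfl

/-- The set `Z(α, m, β; Z(β))`, for a quadruple `q = (α, m, β; x)`. -/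
def cyl (B : Matrix ι ι ℤ) (q : Quad A) : Set (Arrow A B) :=
  {g | ∃ r : Quad A, r.left = q.left ∧ r.deg = q.deg ∧ r.right = q.right ∧ g = mk B r}

lemma seqAppend_get (l : List (Edge A)) (y y' : ℕ → Edge A) (n : ℕ) (h : n < l.length) :
    seqAppend l y n = seqAppend l y' n := by
  induction l generalizing n with
  | nil => simp at h
  | cons a l ih =>
    cases n with
    | zero => rfl
    | succ n => exact ih n (by simpa using h)

lemma seqAppend_of_agree (v : ι) (l : List (Edge A)) (y x : ℕ → Edge A)
    (h : ∀ n ≤ l.length, x n = seqAppend l y n) (hy : endVertex v l = (y 0).src) :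
    x = seqAppend l (fun n => x (n + l.length)) ∧ endVertex v l = (x l.length).src := by
  induction l generalizing v x with
  | nil =>
    refine ⟨rfl, ?_⟩
    rw [hy]; exact congrArg Edge.src (h 0 le_rfl).symm
  | cons a l ih =>
    obtain ⟨h1, h2⟩ := ih a.tgt (fun n => x (n + 1))
      (fun n hn => h (n + 1) (by simpa using hn)) hy
    refine ⟨?_, h2⟩
    funext n
    cases n with
    | zero => exact h 0 (Nat.zero_le _)
    | succ n => exact congrFun h1 n

/-- Every neighbourhood of `x` contains all the paths that agree with `x` long enough. -/
lemma exists_agree {U : Set (InfPath A)} (hU : IsOpen U) {x : InfPath A} (hx : x ∈ U) :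
    ∃ N, ∀ x' : InfPath A, (∀ n < N, x'.edge n = x.edge n) → x' ∈ U := by
  obtain ⟨V, hV, rfl⟩ := isOpen_induced_iff.1 hU
  obtain ⟨I, u, hu, hI⟩ := isOpen_pi_iff.1 hV x.edge hx
  refine ⟨I.sup id + 1, fun x' h => hI fun i hi => ?_⟩
  rw [h i (Nat.lt_succ_of_le (Finset.le_sup (f := id) hi))]
  exact (hu i hi).2

lemma isOpen_agree (x : InfPath A) (N : ℕ) :
    IsOpen {x' : InfPath A | ∀ n < N, x'.edge n = x.edge n} := by
  have : {x' : InfPath A | ∀ n < N, x'.edge n = x.edge n} =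
      ⋂ n ∈ Finset.range N, (fun x' : InfPath A => x'.edge n) ⁻¹' {x.edge n} := by
    ext; simp
  rw [this]
  refine isOpen_biInter_finset fun n _ => ?_
  exact (isOpen_discrete _).preimage ((continuous_apply n).comp continuous_induced_dom)

lemma isOpen_cylinder (β : FinPath A) : IsOpen β.cylinder := by
  rw [isOpen_iff_forall_mem_open]
  rintro x ⟨y, h, rfl⟩
  refine ⟨_, fun x' hx' => ?_, isOpen_agree (β.concat y h) (β.length + 1), fun n _ => rfl⟩
  obtain ⟨h1, h2⟩ := seqAppend_of_agree β.source β.edges y.edge x'.edge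
    (fun n hn => hx' n (Nat.lt_succ_of_le hn)) h
  exact ⟨⟨fun n => x'.edge (n + β.edges.length), fun n => by
    rw [x'.isPath, Nat.add_right_comm]⟩, by rw [FinPath.range, h2]; simp [InfPath.source],
    InfPath.ext h1⟩

lemma isOpen_cyl (q : Quad A) : IsOpen (cyl B q) := by
  refine TopologicalSpace.isOpen_generateFrom_of_mem ⟨q.left, q.deg, q.right, q.right.cylinder,
    q.left_range.trans q.right_range.symm, isOpen_cylinder _, subset_rfl, ?_⟩
  ext g
  constructor
  · rintro ⟨r, h1, h2, h3, rfl⟩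
    refine ⟨r, h1, h2, h3, ?_, rfl⟩
    rw [← h3]; exact ⟨_, r.right_range, rfl⟩
  · rintro ⟨r, h1, h2, h3, -, rfl⟩
    exact ⟨r, h1, h2, h3, rfl⟩

lemma mem_cyl (q : Quad A) : mk B q ∈ cyl B q := ⟨q, rfl, rfl, rfl, rfl⟩

lemma exists_refine (q r : Quad A) (h1 : r.left = (q.refine B).left)
    (h2 : r.deg = (q.refine B).deg) (h3 : r.right = (q.refine B).right) :
    ∃ r0 : Quad A, r0.left = q.left ∧ r0.deg = q.deg ∧ r0.right = q.right ∧ r0.refine B = r := by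
  have hr : (q.tail.edge 0).tgt = r.tail.source := by
    rw [← r.right_range, h3]; exact (FinPath.range_snoc _ _ q.right_range).symm
  refine ⟨⟨q.left, q.deg, q.right, ⟨fun n => seqAppend [q.tail.edge 0] r.tail.edge n, ?_⟩,
    q.left_range, q.right_range⟩, rfl, rfl, rfl, ?_⟩
  · intro n
    cases n with
    | zero => exact hr
    | succ n => exact r.tail.isPath n
  · exact Quad.ext h1.symm h2.symm h3.symm rfl

lemma exists_iterate (q r : Quad A) (n : ℕ) (h1 : r.left = ((Quad.refine B)^[n] q).left)
    (h2 : r.deg = ((Quad.refine B)^[n] q).deg) (h3 : r.right = ((Quad.refine B)^[n] q).right) :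
    ∃ r0 : Quad A, r0.left = q.left ∧ r0.deg = q.deg ∧ r0.right = q.right ∧
      (Quad.refine B)^[n] r0 = r := by
  induction n generalizing r with
  | zero => exact ⟨r, h1, h2, h3, rfl⟩
  | succ n ih =>
    rw [Function.iterate_succ_apply'] at h1 h2 h3
    obtain ⟨r1, a1, a2, a3, rfl⟩ := exists_refine _ r h1 h2 h3
    obtain ⟨r0, b1, b2, b3, rfl⟩ := ih r1 a1 a2 a3
    exact ⟨r0, b1, b2, b3, Function.iterate_succ_apply' _ _ _⟩

lemma src_agree {q r : Quad A} (h : r.right = q.right) (n : ℕ) (hn : n < q.right.length) :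
    r.src.edge n = q.src.edge n := by
  simp only [Quad.src, FinPath.concat, h]
  exact seqAppend_get _ _ _ _ hn

lemma rng_agree {q r : Quad A} (h : r.left = q.left) (n : ℕ) (hn : n < q.left.length) :
    (r.rng B).edge n = (q.rng B).edge n := by
  simp only [Quad.rng, FinPath.concat, h]
  exact seqAppend_get _ _ _ _ hn

/-- The sets `Z(α, m, β; Z(β))` form a basis of the topology. -/
lemma exists_cyl_subset {S : Set (Arrow A B)} (hS : IsOpen S) (q : Quad A) (hq : mk B q ∈ S) :
    ∃ N, ∀ n ≥ N, cyl B ((Quad.refine B)^[n] q) ⊆ S := by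
  induction hS with
  | basic S hS =>
    obtain ⟨α, m, β, U, hr, hU, hUβ, rfl⟩ := hS
    obtain ⟨q0, rfl, rfl, rfl, hq0, e⟩ := hq
    obtain ⟨a, b, e⟩ := (mk_eq_iff _ _).1 e
    obtain ⟨N, hN⟩ := exists_agree hU hq0
    refine ⟨a + N, fun n hn => ?_⟩
    obtain ⟨c, rfl⟩ : ∃ c, n = c + a := ⟨n - a, by omega⟩
    rw [Function.iterate_add_apply, e, ← Function.iterate_add_apply]
    rintro g ⟨r, h1, h2, h3, rfl⟩
    obtain ⟨r0, b1, b2, b3, rfl⟩ := exists_iterate _ r _ h1 h2 h3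
    refine ⟨r0, b1, b2, b3, hN _ fun i hi => ?_, mk_iterate _ _⟩
    have := src_agree h3 i (by rw [Quad.length_right_iterate]; omega)
    rwa [Quad.src_iterate, Quad.src_iterate] at this
  | univ => exact ⟨0, fun _ _ => Set.subset_univ _⟩
  | inter s t _ _ ih1 ih2 =>
    obtain ⟨N1, h1⟩ := ih1 hq.1
    obtain ⟨N2, h2⟩ := ih2 hq.2
    exact ⟨max N1 N2, fun n hn => Set.subset_inter (h1 n (le_of_max_le_left hn))
      (h2 n (le_of_max_le_right hn))⟩
  | sUnion S _ ih =>
    obtain ⟨s, hs, hqs⟩ := hq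
    obtain ⟨N, h⟩ := ih s hs hqs
    exact ⟨N, fun n hn => (h n hn).trans (Set.subset_sUnion_of_mem hs)⟩

lemma mem_cyl_iterate (q : Quad A) (n : ℕ) : mk B q ∈ cyl B ((Quad.refine B)^[n] q) := by
  rw [← mk_iterate q n]; exact mem_cyl _

lemma continuous_src : Continuous (src : Arrow A B → InfPath A) := by
  refine ⟨fun W hW => isOpen_iff_forall_mem_open.2 fun g hg => ?_⟩
  obtain ⟨q, rfl⟩ := exists_mk g
  obtain ⟨N, hN⟩ := exists_agree hW hg
  refine ⟨_, ?_, isOpen_cyl ((Quad.refine B)^[N] q), mem_cyl_iterate q N⟩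
  rintro _ ⟨r, -, -, h3, rfl⟩
  refine hN _ fun n hn => ?_
  have := src_agree h3 n (by rw [Quad.length_right_iterate]; omega)
  rwa [Quad.src_iterate] at this

lemma continuous_rng : Continuous (rng : Arrow A B → InfPath A) := by
  refine ⟨fun W hW => isOpen_iff_forall_mem_open.2 fun g hg => ?_⟩
  obtain ⟨q, rfl⟩ := exists_mk g
  obtain ⟨N, hN⟩ := exists_agree hW hg
  refine ⟨_, ?_, isOpen_cyl ((Quad.refine B)^[N] q), mem_cyl_iterate q N⟩
  rintro _ ⟨r, h1, -, -, rfl⟩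
  refine hN _ fun n hn => ?_
  have := rng_agree (B := B) h1 n (by rw [Quad.length_left_iterate]; omega)
  rwa [Quad.rng_iterate] at this

lemma continuous_inv : Continuous (inv : Arrow A B → Arrow A B) := by
  refine ⟨fun S hS => isOpen_iff_forall_mem_open.2 fun g hg => ?_⟩
  obtain ⟨q, rfl⟩ := exists_mk g
  obtain ⟨N, hN⟩ := exists_cyl_subset hS (q.inv B) hg
  refine ⟨_, ?_, isOpen_cyl ((Quad.refine B)^[N] q), mem_cyl_iterate q N⟩
  rintro _ ⟨r, h1, h2, h3, rfl⟩
  refine hN N le_rfl ⟨r.inv B, ?_⟩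
  rw [← Quad.inv_iterate]
  exact ⟨h3, congrArg Neg.neg h2, h1, rfl⟩

lemma continuous_unit : Continuous (unit B : InfPath A → Arrow A B) := by
  refine ⟨fun S hS => isOpen_iff_forall_mem_open.2 fun x hx => ?_⟩
  obtain ⟨N, hN⟩ := exists_cyl_subset hS _ hx
  have h := hN N le_rfl
  have hs := Quad.src_iterate (B := B) (Quad.idem (FinPath.vertex A x.source) x rfl) N
  obtain ⟨β, y, h', e⟩ := Quad.iterate_idem (B := B) (FinPath.vertex A x.source) x rfl N
  rw [e] at h hs
  refine ⟨β.cylinder, ?_, isOpen_cylinder β, ⟨y, h', hs.symm⟩⟩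
  rintro _ ⟨y1, h1, rfl⟩
  exact h ⟨Quad.idem β y1 h1, rfl, rfl, rfl, unit_src (Quad.idem β y1 h1)⟩

lemma continuous_mul : Continuous
    (fun p : {p : Arrow A B × Arrow A B // src p.1 = rng p.2} => mul p.1.1 p.1.2 p.2) := by
  refine ⟨fun S hS => isOpen_iff_forall_mem_open.2 ?_⟩
  rintro ⟨⟨g, h⟩, e⟩ hS'
  obtain ⟨q, p, c, rfl, rfl, hk⟩ := mul_spec g h e
  have hS'' : mk B (q.comp p c) ∈ S := by rw [← hk]; exact hS'
  obtain ⟨N, hN⟩ := exists_cyl_subset hS _ hS''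
  have hN := hN N le_rfl
  obtain ⟨c', ec⟩ := Quad.comp_iterate c N
  rw [← ec] at hN
  refine ⟨Subtype.val ⁻¹' (cyl B ((Quad.refine B)^[N] q) ×ˢ cyl B ((Quad.refine B)^[N] p)), ?_,
    ((isOpen_cyl _).prod (isOpen_cyl _)).preimage continuous_subtype_val,
    ⟨mem_cyl_iterate q N, mem_cyl_iterate p N⟩⟩
  rintro ⟨⟨g1, h1⟩, e1⟩ ⟨⟨r, a1, a2, a3, hr⟩, ⟨t, b1, b2, b3, ht⟩⟩
  dsimp only at hr ht
  subst hr ht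
  have d : Quad.Composable B r t := by
    apply Quad.composable_of
    · exact e1
    · rw [a3, b1, c'.1]
  refine hN ⟨r.comp t d, a1, ?_, b3, mul_mk d e1⟩
  change r.deg + t.deg = _
  rw [a2, b2]; rfl

end Arrow

/-- The Katsura-Exel-Pardo groupoid `G_{A,B}`, with unit space the infinite path space. -/
noncomputable def kepGroupoid (A B : Matrix ι ι ℤ) : TopGroupoid.{u, u} (InfPath A) where
  Arrow := Arrow A B
  src := Arrow.src
  rng := Arrow.rng
  unit := Arrow.unit B
  inv := Arrow.inv
  mul := Arrow.mul
  src_unit := Arrow.src_unit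
  rng_unit := Arrow.rng_unit
  src_inv := Arrow.src_inv
  rng_inv := Arrow.rng_inv
  src_mul := Arrow.src_mul
  rng_mul := Arrow.rng_mul
  mul_assoc := Arrow.mul_assoc
  mul_unit := Arrow.mul_unit
  unit_mul := Arrow.unit_mul
  inv_mul := Arrow.inv_mul
  mul_inv := Arrow.mul_inv
  continuous_src := Arrow.continuous_src
  continuous_rng := Arrow.continuous_rng
  continuous_unit := Arrow.continuous_unit
  continuous_inv := Arrow.continuous_inv
  continuous_mul := Arrow.continuous_mul

/-- The restriction of `G_{A,B}` to `Z(v)`. -/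
noncomputable def restrictedKepGroupoid (A B : Matrix ι ι ℤ) (v : ι) :
    TopGroupoid.{u, u} (FinPath.vertex A v).cylinder :=
  (kepGroupoid A B).restrict (FinPath.vertex A v).cylinder

end KatsuraGroupoid

/-! ## Bratteli diagrams -/

/-- A Bratteli diagram with vertex set `V` and edge set `E`: `V` is the disjoint union of finite
non-empty sets `V_n = {v | level v = n}` with `V_0 = {root}`, and `E` is the union of the finite
non-empty sets `E_{n+1}` of edges from `V_n` to `V_{n+1}`. -/
structure BratteliDiagram (V : Type u) (E : Type v) where
  level : V → ℕ
  root : V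
  src : E → V
  tgt : E → V
  level_eq_zero_iff : ∀ v, level v = 0 ↔ v = root
  finite_vertices : ∀ n, {v | level v = n}.Finite
  nonempty_vertices : ∀ n, {v | level v = n}.Nonempty
  level_tgt : ∀ e, level (tgt e) = level (src e) + 1
  finite_edges : ∀ n, {e | level (src e) = n}.Finite
  nonempty_edges : ∀ n, {e | level (src e) = n}.Nonempty

/-- The incidence matrix of a Bratteli diagram, relative to an enumeration of its vertices by `ι`:
the `(i, j)` entry is the number of edges from the `i`-th to the `j`-th vertex. -/
noncomputable def BratteliDiagram.incidenceMatrix {V : Type u} {E : Type v} {ι : Type*}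
    (D : BratteliDiagram V E) (enum : ι ≃ V) : Matrix ι ι ℤ :=
  fun i j => (Nat.card {e : E // D.src e = enum i ∧ D.tgt e = enum j} : ℤ)

/-! Invariance can be expressed without `B`: a probability measure on Z(v) is invariant exactly when
the measure of Z(α), for α a finite path from v, depends only on r(α)
(`mem_invariantProbabilityMeasures_iff`). This condition involves the graph of `A` alone, so it is
the same for `B` and for 0.

The reason is that each κ_m permutes the infinite paths starting at a given vertex. The basic set
Z(α, m, β; Z(β)) is therefore a bisection with source Z(β) and range all of Z(α), whatever m and `B`
are (`Arrow.src_image_cyl`, `Arrow.rng_image_cyl`). Taking m = 0 shows that the condition is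
necessary.

For sufficiency, cylinders are nested or disjoint, so an open set on which s is injective splits
into basic sets with pairwise disjoint sources (`Arrow.exists_partition`). On a bisection the ranges
are disjoint too. There are countably many pieces, because a Bratteli diagram has countably many
vertices, so countable additivity reduces the claim to a comparison of Z(α) with Z(β) piece by
piece. -/

namespace KatsuraGroupoid

open MeasureTheory

section

variable {ι : Type*} {A B : Matrix ι ι ℤ}

/-! ### Countability of edges and finite paths -/

instance [Countable ι] : Countable (Edge A) :=
  Function.Injective.countable (f := fun e : Edge A => (e.src, e.tgt, e.idx)) fun e e' h => by
    simp only [Prod.mk.injEq] at h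
    exact Edge.ext h.1 h.2.1 h.2.2

/-- Makes the partition of a bisection, which is indexed by finite paths, a countable one. -/
instance [Countable ι] : Countable (FinPath A) :=
  Function.Injective.countable (f := fun α : FinPath A => (α.source, α.edges)) fun α α' h => by
    simp only [Prod.mk.injEq] at h
    exact FinPath.ext h.1 h.2

/-! ### Cylinder sets as a tree -/

/-- A sharper form of `Arrow.seqAppend_of_agree`: since z is itself a path from v, agreement on the
edges of l is enough, and the edge after them need not be compared. -/
lemma seqAppend_drop (v : ι) (l : List (Edge A)) (z : ℕ → Edge A)
    (hz : (z 0).src = v) (hp : ∀ n, (z n).tgt = (z (n + 1)).src)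
    (y : ℕ → Edge A) (h : ∀ n < l.length, z n = seqAppend l y n) :
    z = seqAppend l (fun n => z (n + l.length)) ∧ endVertex v l = (z l.length).src := by
  induction l generalizing v z with
  | nil => exact ⟨rfl, hz.symm⟩
  | cons a l ih =>
    have h0 : z 0 = a := h 0 (Nat.succ_pos _)
    obtain ⟨h1, h2⟩ := ih a.tgt (fun n => z (n + 1)) (by rw [← hp, h0]) (fun n => hp (n + 1))
      (fun n hn => h (n + 1) (Nat.succ_lt_succ hn))
    refine ⟨?_, h2⟩
    funext n
    cases n with
    | zero => exact h0
    | succ n => exact congrFun h1 n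

namespace FinPath

/-- The condition on sources matters only for β of length zero, where there is no edge to compare.
-/
lemma mem_cylinder_of_agree {β : FinPath A} {x z : InfPath A} (hx : x ∈ β.cylinder)
    (hs : z.source = x.source) (h : ∀ n < β.length, z.edge n = x.edge n) : z ∈ β.cylinder := by
  obtain ⟨y, hy, rfl⟩ := hx
  obtain ⟨h1, h2⟩ := seqAppend_drop β.source β.edges z.edge
    (hs.trans (source_concat β y hy)) z.isPath y.edge h
  exact ⟨⟨fun n => z.edge (n + β.edges.length), fun n => by rw [z.isPath, Nat.add_right_comm]⟩,
    by rw [FinPath.range, h2]; simp [InfPath.source], InfPath.ext h1⟩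

lemma source_of_mem_cylinder {β : FinPath A} {x : InfPath A} (hx : x ∈ β.cylinder) :
    x.source = β.source := by
  obtain ⟨y, hy, rfl⟩ := hx
  exact source_concat β y hy

lemma edge_eq_of_mem_cylinder {β : FinPath A} {x z : InfPath A} (hx : x ∈ β.cylinder)
    (hz : z ∈ β.cylinder) (n : ℕ) (hn : n < β.length) : z.edge n = x.edge n := by
  obtain ⟨y, hy, rfl⟩ := hx
  obtain ⟨y', hy', rfl⟩ := hz
  exact Arrow.seqAppend_get _ _ _ _ hn

/-- Both paths are initial segments of x, so the shorter one is an initial segment of the longer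
one: cylinders that meet are nested. -/
lemma cylinder_subset {β β' : FinPath A} {x : InfPath A} (hx : x ∈ β.cylinder)
    (hx' : x ∈ β'.cylinder) (hl : β'.length ≤ β.length) : β.cylinder ⊆ β'.cylinder :=
  fun _ hz => mem_cylinder_of_agree hx'
    ((source_of_mem_cylinder hz).trans (source_of_mem_cylinder hx).symm)
    fun n hn => edge_eq_of_mem_cylinder hx hz n (hn.trans_le hl)

lemma eq_of_mem_cylinder {β β' : FinPath A} {x : InfPath A} (hx : x ∈ β.cylinder)
    (hx' : x ∈ β'.cylinder) (hl : β.length = β'.length) : β = β' := by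
  obtain ⟨y, hy, rfl⟩ := hx
  obtain ⟨y', hy', e⟩ := hx'
  exact (concat_inj _ _ _ _ _ _ hl e).1

lemma mem_cylinder_vertex {v : ι} {x : InfPath A} : x ∈ (vertex A v).cylinder ↔ x.source = v :=
  ⟨source_of_mem_cylinder, fun h => ⟨x, h.symm, rfl⟩⟩

end FinPath

/-! ### Basic sets of arrows: sources, ranges and partitions -/

namespace InfPath

lemma act_neg_act (m : ℤ) (y : InfPath A) : (y.act B m).act B (-m) = y := by
  rw [← act_add, neg_add_cancel, act_zero]

lemma act_act_neg (m : ℤ) (y : InfPath A) : (y.act B (-m)).act B m = y := by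
  rw [← act_add, add_neg_cancel, act_zero]

end InfPath

namespace Arrow

lemma src_image_cyl (q : Quad A) : src '' cyl B q = q.right.cylinder := by
  ext x
  constructor
  · rintro ⟨_, ⟨r, -, -, h3, rfl⟩, rfl⟩
    rw [← h3]
    exact ⟨r.tail, r.right_range, rfl⟩
  · rintro ⟨y, h, rfl⟩
    exact ⟨_, ⟨⟨q.left, q.deg, q.right, y,
      (q.left_range.trans q.right_range.symm).trans h, h⟩, rfl, rfl, rfl, rfl⟩, rfl⟩

/-- The map κ_m is a bijection of the infinite paths from a given vertex, so the tails κ_m(y)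
exhaust them. This is where the dependence on m and `B` disappears. -/
lemma rng_image_cyl (q : Quad A) : rng '' cyl B q = q.left.cylinder := by
  ext x
  constructor
  · rintro ⟨_, ⟨r, h1, -, -, rfl⟩, rfl⟩
    rw [← h1]
    exact ⟨r.tail.act B r.deg, r.left_range, rfl⟩
  · rintro ⟨y, h, rfl⟩
    -- The tail κ_{-m}(y) is the one that κ_m sends to y.
    refine ⟨_, ⟨⟨q.left, q.deg, q.right, y.act B (-q.deg), h,
      (q.right_range.trans q.left_range.symm).trans h⟩, rfl, rfl, rfl, rfl⟩, ?_⟩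
    apply InfPath.ext
    exact congrArg (fun z : InfPath A => seqAppend q.left.edges z.edge)
      (InfPath.act_act_neg q.deg y)

lemma injOn_src_cyl (q : Quad A) : Set.InjOn src (cyl B q) := by
  rintro _ ⟨r, h1, h2, h3, rfl⟩ _ ⟨t, k1, k2, k3, rfl⟩ e
  have ht := (FinPath.concat_inj _ _ _ _ r.right_range t.right_range (by rw [h3, k3]) e).2
  exact congrArg (mk B) (Quad.ext (h1.trans k1.symm) (h2.trans k2.symm) (h3.trans k3.symm) ht)

/-- The common prefix α cancels, and κ_{-m} then recovers the tail. -/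
lemma injOn_rng_cyl (q : Quad A) : Set.InjOn rng (cyl B q) := by
  rintro _ ⟨r, h1, h2, h3, rfl⟩ _ ⟨t, k1, k2, k3, rfl⟩ e
  have ht := (FinPath.concat_inj _ _ (r.tail.act B r.deg) (t.tail.act B t.deg)
    r.left_range t.left_range (by rw [h1, k1]) e).2
  rw [h2, k2] at ht
  have ht' := congrArg (fun z => InfPath.act B (-q.deg) z) ht
  simp only [InfPath.act_neg_act] at ht'
  exact congrArg (mk B) (Quad.ext (h1.trans k1.symm) (h2.trans k2.symm) (h3.trans k3.symm) ht')

/-- An open set of arrows on which `src` is injective is partitioned into sets `Z(α, m, β; Z(β))`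
indexed by pairwise disjoint cylinders `Z(β)`. -/
lemma exists_partition {S : Set (Arrow A B)} (hS : IsOpen S) (hs : Set.InjOn src S) :
    ∃ (T : Set (FinPath A)) (q : T → Quad A), (∀ β, (q β).right = β) ∧
      (∀ β β' : T, ∀ x, x ∈ β.1.cylinder → x ∈ β'.1.cylinder → β = β') ∧
      S = ⋃ β, cyl B (q β) := by
  -- The index set consists of the shortest admissible β, those whose cylinder meets no strictly
  -- shorter source cylinder of a basic set inside S. These cylinders are the maximal ones, hence
  -- disjoint.
  let T : Set (FinPath A) := {β | ∃ q : Quad A, q.right = β ∧ cyl B q ⊆ S ∧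
    ∀ q' : Quad A, cyl B q' ⊆ S → ∀ x ∈ β.cylinder, x ∈ q'.right.cylinder →
      β.length ≤ q'.right.length}
  choose q hq1 hq2 hq3 using fun β : T => β.2
  refine ⟨T, q, hq1, fun β β' x h h' => ?_, Set.Subset.antisymm (fun g hg => ?_)
    (Set.iUnion_subset hq2)⟩
  · refine Subtype.ext (FinPath.eq_of_mem_cylinder h h' (le_antisymm ?_ ?_))
    · have := hq3 β (q β') (hq2 β') x h (by rwa [hq1])
      rwa [hq1] at this
    · have := hq3 β' (q β) (hq2 β) x h' (by rwa [hq1])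
      rwa [hq1] at this
  -- Refining a representative of g far enough gives a basic set inside S; among all candidates over
  -- s(g), one with shortest source path is taken.
  · have hex : ∃ n, ∃ p : Quad A, cyl B p ⊆ S ∧ src g ∈ p.right.cylinder ∧
        p.right.length = n := by
      obtain ⟨p, rfl⟩ := exists_mk g
      obtain ⟨N, hN⟩ := exists_cyl_subset hS p hg
      refine ⟨_, _, hN N le_rfl, ?_, rfl⟩
      rw [← src_image_cyl (B := B)]
      exact ⟨_, mem_cyl_iterate p N, rfl⟩
    classical
    obtain ⟨p, hp, hgp, hn⟩ := Nat.find_spec hex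
    have hT : p.right ∈ T := by
      -- Minimality at s(g) propagates to all of Z(β): a shorter cylinder meeting Z(β) contains it,
      -- hence contains s(g).
      refine ⟨p, rfl, hp, fun q' hq' x hx hx' => ?_⟩
      by_contra! hlt
      exact Nat.find_min hex (hn ▸ hlt)
        ⟨q', hq', FinPath.cylinder_subset hx hx' hlt.le hgp, rfl⟩
    -- The quadruple chosen for this path may differ from `p`, but its basic set lies in S and
    -- contains an arrow with source s(g), which is g by injectivity of s.
    have hg' : src g ∈ src '' cyl B (q ⟨p.right, hT⟩) := by
      rw [src_image_cyl, hq1]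
      exact hgp
    obtain ⟨g', hg', e⟩ := hg'
    exact Set.mem_iUnion.2 ⟨_, hs (hq2 _ hg') hg e ▸ hg'⟩

end Arrow

/-! ### Invariance as a condition on cylinder measures -/

lemma measurableSet_val_preimage_cylinder (v : ι) (β : FinPath A) :
    MeasurableSet ((Subtype.val : (FinPath.vertex A v).cylinder → InfPath A) ⁻¹' β.cylinder) :=
  ((Arrow.isOpen_cylinder β).preimage continuous_subtype_val).measurableSet

/-- The invariant probability measures are those giving the same measure to all cylinder sets
`Z(α)` with `α` a path from `v` to a given vertex. -/
theorem mem_invariantProbabilityMeasures_iff [Countable ι] (B : Matrix ι ι ℤ) (v : ι)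
    (μ : ProbabilityMeasure (FinPath.vertex A v).cylinder) :
    μ ∈ (restrictedKepGroupoid A B v).invariantProbabilityMeasures ↔
      ∀ α β : FinPath A, α.source = v → β.source = v → α.range = β.range →
        (μ : Measure (FinPath.vertex A v).cylinder) (Subtype.val ⁻¹' α.cylinder) =
          (μ : Measure (FinPath.vertex A v).cylinder) (Subtype.val ⁻¹' β.cylinder) := by
  constructor
  · intro hμ α β hα hβ hr
    -- A quadruple needs a tail. If no infinite path starts at r(β), both cylinders are empty.
    by_cases hy : ∃ y : InfPath A, β.range = y.source
    · obtain ⟨y, hy⟩ := hy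
      let q : Quad A := ⟨α, 0, β, y, hr.trans hy, hy⟩
      let U : Set (restrictedKepGroupoid A B v).Arrow := Subtype.val ⁻¹' Arrow.cyl B q
      have hU : (restrictedKepGroupoid A B v).IsBisection U :=
        ⟨(Arrow.isOpen_cyl q).preimage continuous_subtype_val,
          fun g hg h hh e => Subtype.ext (Arrow.injOn_src_cyl q hg hh (congrArg Subtype.val e)),
          fun g hg h hh e => Subtype.ext (Arrow.injOn_rng_cyl q hg hh (congrArg Subtype.val e))⟩
      -- Restricting to Z(v) loses no arrow of the basic set, as α and β start at v; its source and
      -- range therefore remain full cylinders.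
      have hmem : ∀ g ∈ Arrow.cyl B q, Arrow.src g ∈ (FinPath.vertex A v).cylinder ∧
          Arrow.rng g ∈ (FinPath.vertex A v).cylinder := fun g hg => by
        constructor
        · have := (Arrow.src_image_cyl (B := B) q).subset ⟨g, hg, rfl⟩
          exact FinPath.mem_cylinder_vertex.2 ((FinPath.source_of_mem_cylinder this).trans hβ)
        · have := (Arrow.rng_image_cyl (B := B) q).subset ⟨g, hg, rfl⟩
          exact FinPath.mem_cylinder_vertex.2 ((FinPath.source_of_mem_cylinder this).trans hα)
      have e1 : (restrictedKepGroupoid A B v).src '' U = Subtype.val ⁻¹' β.cylinder := by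
        ext x
        rw [Set.mem_preimage, ← Arrow.src_image_cyl (B := B) q]
        constructor
        · rintro ⟨g, hg, rfl⟩
          exact ⟨g.1, hg, rfl⟩
        · rintro ⟨g, hg, e⟩
          exact ⟨⟨g, hmem g hg⟩, hg, Subtype.ext e⟩
      have e2 : (restrictedKepGroupoid A B v).rng '' U = Subtype.val ⁻¹' α.cylinder := by
        ext x
        rw [Set.mem_preimage, ← Arrow.rng_image_cyl (B := B) q]
        constructor
        · rintro ⟨g, hg, rfl⟩
          exact ⟨g.1, hg, rfl⟩
        · rintro ⟨g, hg, e⟩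
          exact ⟨⟨g, hmem g hg⟩, hg, Subtype.ext e⟩
      rw [← e1, ← e2]
      exact (hμ U hU).symm
    · have e1 : α.cylinder = ∅ := Set.eq_empty_of_forall_notMem fun _ ⟨y, h, _⟩ =>
        hy ⟨y, hr.symm.trans h⟩
      have e2 : β.cylinder = ∅ := Set.eq_empty_of_forall_notMem fun _ ⟨y, h, _⟩ => hy ⟨y, h⟩
      rw [e1, e2]
  · rintro h U ⟨hU, hs, hr⟩
    -- The partition is carried out in the unrestricted groupoid, where U remains open because Z(v)
    -- is open.
    let S : Set (Arrow A B) := Subtype.val '' U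
    have hY : IsOpen {g : Arrow A B | Arrow.src g ∈ (FinPath.vertex A v).cylinder ∧
        Arrow.rng g ∈ (FinPath.vertex A v).cylinder} :=
      ((Arrow.isOpen_cylinder _).preimage Arrow.continuous_src).inter
        ((Arrow.isOpen_cylinder _).preimage Arrow.continuous_rng)
    have hS : IsOpen S := hY.isOpenMap_subtype_val U hU
    have hSs : Set.InjOn Arrow.src S := by
      rintro _ ⟨g, hg, rfl⟩ _ ⟨k, hk, rfl⟩ e
      exact congrArg Subtype.val (hs hg hk (Subtype.ext e))
    have hSr : Set.InjOn Arrow.rng S := by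
      rintro _ ⟨g, hg, rfl⟩ _ ⟨k, hk, rfl⟩ e
      exact congrArg Subtype.val (hr hg hk (Subtype.ext e))
    obtain ⟨T, q, hq, hT, hST⟩ := Arrow.exists_partition hS hSs
    have e1 : (restrictedKepGroupoid A B v).src '' U =
        ⋃ β : T, Subtype.val ⁻¹' (q β).right.cylinder := by
      ext x
      have hx : x ∈ (restrictedKepGroupoid A B v).src '' U ↔ x.1 ∈ Arrow.src '' S :=
        ⟨fun ⟨g, hg, e⟩ => ⟨g.1, ⟨g, hg, rfl⟩, congrArg Subtype.val e⟩,
          fun ⟨_, ⟨g, hg, rfl⟩, e⟩ => ⟨g, hg, Subtype.ext e⟩⟩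
      simp only [hx, hST, Set.image_iUnion, Arrow.src_image_cyl, Set.mem_iUnion,
        Set.mem_preimage]
    have e2 : (restrictedKepGroupoid A B v).rng '' U =
        ⋃ β : T, Subtype.val ⁻¹' (q β).left.cylinder := by
      ext x
      have hx : x ∈ (restrictedKepGroupoid A B v).rng '' U ↔ x.1 ∈ Arrow.rng '' S :=
        ⟨fun ⟨g, hg, e⟩ => ⟨g.1, ⟨g, hg, rfl⟩, congrArg Subtype.val e⟩,
          fun ⟨_, ⟨g, hg, rfl⟩, e⟩ => ⟨g, hg, Subtype.ext e⟩⟩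
      simp only [hx, hST, Set.image_iUnion, Arrow.rng_image_cyl, Set.mem_iUnion,
        Set.mem_preimage]
    rw [e1, e2, measure_iUnion, measure_iUnion]
    · refine tsum_congr fun β => ?_
      -- The arrow represented by `q β` comes from U, so its source and range lie in Z(v); this
      -- forces both finite paths to start at v.
      have hm : Arrow.mk B (q β) ∈ S := hST ▸ Set.mem_iUnion.2 ⟨β, Arrow.mem_cyl _⟩
      obtain ⟨g, -, hg⟩ := hm
      have h1 := g.2
      rw [hg] at h1
      refine h _ _ ?_ ?_ ((q β).right_range.trans (q β).left_range.symm)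
      · exact (FinPath.source_concat _ _ (q β).right_range).symm.trans (FinPath.mem_cylinder_vertex.1 h1.1)
      · exact (FinPath.source_concat _ ((q β).tail.act B (q β).deg) (q β).left_range).symm.trans
          (FinPath.mem_cylinder_vertex.1 h1.2)
    -- A point in two range cylinders comes from a single arrow, by injectivity of r, and the source
    -- of that arrow lies in both source cylinders.
    · intro β β' hne
      refine Set.disjoint_left.2 fun x hx hx' => hne ?_
      rw [Set.mem_preimage, ← Arrow.rng_image_cyl (B := B)] at hx hx'
      obtain ⟨g, hg, e⟩ := hx
      obtain ⟨g', hg', e'⟩ := hx'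
      have : g = g' := hSr (hST ▸ Set.mem_iUnion.2 ⟨β, hg⟩) (hST ▸ Set.mem_iUnion.2 ⟨β', hg'⟩)
        (e.trans e'.symm)
      subst this
      refine hT β β' (Arrow.src g) ?_ ?_
      · rw [← hq, ← Arrow.src_image_cyl (B := B)]; exact ⟨g, hg, rfl⟩
      · rw [← hq, ← Arrow.src_image_cyl (B := B)]; exact ⟨g, hg', rfl⟩
    · exact fun β => measurableSet_val_preimage_cylinder v _
    · intro β β' hne
      refine Set.disjoint_left.2 fun x hx hx' => hne (hT β β' x.1 ?_ ?_)
      · rw [← hq]; exact hx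
      · rw [← hq]; exact hx'
    · exact fun β => measurableSet_val_preimage_cylinder v _

end

end KatsuraGroupoid

/-! ### Application to Bratteli diagrams -/

lemma BratteliDiagram.countable_vertices {V E : Type*} (D : BratteliDiagram V E) :
    Countable V := by
  rw [← Set.countable_univ_iff]
  refine (Set.countable_iUnion fun n => (D.finite_vertices n).countable).mono fun v _ => ?_
  exact Set.mem_iUnion.2 ⟨D.level v, rfl⟩

theorem mainTheorem11 {ι V E W F : Type*}
    (D : BratteliDiagram V E) (D' : BratteliDiagram W F)
    (enumV : ι ≃ V) (enumW : ι ≃ W)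
    (A B : Matrix ι ι ℤ)
    (hA : A = D.incidenceMatrix enumV) (hB : B = D'.incidenceMatrix enumW)
    (hBA : ∀ i j : ι, A i j ≠ 0 → |B i j| < A i j) :
    (KatsuraGroupoid.restrictedKepGroupoid A B (enumV.symm D.root)).invariantProbabilityMeasures =
      (KatsuraGroupoid.restrictedKepGroupoid A 0
        (enumV.symm D.root)).invariantProbabilityMeasures := by
  have := D.countable_vertices
  have : Countable ι := enumV.countable_iff.2 this
  ext μ
  -- The criterion does not mention the second matrix, so both memberships become the same
  -- statement.
  rw [KatsuraGroupoid.mem_invariantProbabilityMeasures_iff,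
    KatsuraGroupoid.mem_invariantProbabilityMeasures_iff]
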